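/- For $X\in M_n(\mathbb C)$ let $S_X : M_n(\mathbb C)\to M_n(\mathbb C)$, $S_X(Y)=X\circ Y$, be the entrywise multiplication $(X\circ Y)_{(i,j)}=X_{(i,j)}Y_{(i,j)}$, and let the Schur multiplier norm $\|S_X\|$ of $X$ be the norm of this linear operator when $M_n(\mathbb C)$ carries the operator norm (of matrices acting on the Hilbert space $\mathbb C^n$). Let $\mathcal Q_n$ be the set of positive semidefinite matrices in $M_n(\mathbb C)$ all of whose diagonal entries are equal to $1$. Then $\mathcal Q_n$ is a face of the unit ball $\{X\in M_n(\mathbb C) : \|S_X\|\le 1\}$ of the Schur multipliers, that is, a convex extreme subset of it. In particular, if $0<\alpha<1$, $X\in\mathcal Q_n$, and $Y,Z\in M_n(\mathbb C)$ satisfy $\|S_Y\|\le 1$, $\|S_Z\|\le 1$ and $X=(1-\alpha)Y+\alpha Z$, then both $Y$ and $Z$ belong to $\mathcal Q_n$. -/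

import Mathlib

open scoped ComplexOrder Matrix Matrix.Norms.L2Operator

/-- The Schur multiplier `S_X : Y ↦ X ∘ Y` (entrywise product), as a linear map on the space of
complex `m × n` matrices. -/
def schurMul {m n : ℕ} (X : Matrix (Fin m) (Fin n) ℂ) :
    Matrix (Fin m) (Fin n) ℂ →ₗ[ℂ] Matrix (Fin m) (Fin n) ℂ where
  toFun Y := X ⊙ Y
  map_add' Y Z := Matrix.hadamard_add X Y Z
  map_smul' c Y := Matrix.hadamard_smul X Y c

/-- The Schur multiplier norm of `X`: the norm of `S_X` as a linear operator on the space of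
`m × n` matrices, which carries the operator norm (from `ℓ²` to `ℓ²`). -/
noncomputable def schurNorm {m n : ℕ} (X : Matrix (Fin m) (Fin n) ℂ) : ℝ :=
  ‖(schurMul X).toContinuousLinearMap‖

/-- The unit ball of the Schur multipliers on `M_n(ℂ)`. -/
def schurBall (n : ℕ) : Set (Matrix (Fin n) (Fin n) ℂ) :=
  {X | schurNorm X ≤ 1}

/-- `𝒬_n`: the positive (semidefinite) complex `n × n` matrices with unit diagonal. -/
def unitDiagPos (n : ℕ) : Set (Matrix (Fin n) (Fin n) ℂ) :=
  {X | X.PosSemidef ∧ ∀ i, X i i = 1}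

/-! A contractive Schur multiplier has diagonal entries in the closed unit disc, where 1 is an
extreme point, so a convex decomposition of `X` forces unit diagonals on both terms. It remains to
see that contractivity and unit diagonal give positivity (`posSemidef_of_mem_schurBall`). Let `J` be
the all-ones matrix, with spectrum in `{0, n}`. If `Re c = n/2`, then `‖J - c‖ ≤ |c|`, and the Schur
product of `X` with `J - c` is `X - c`; hence `‖X - c‖ ≤ |c|`. The numerical range of `X` thus lies
in all discs with such centres `c` and 0 on the boundary, whose intersection is the segment `[0,
n]`. -/

theorem norm_hadamard_le_schurNorm_mul {m n : ℕ} (X A : Matrix (Fin m) (Fin n) ℂ) :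
    ‖X ⊙ A‖ ≤ schurNorm X * ‖A‖ :=
  (schurMul X).toContinuousLinearMap.le_opNorm A

theorem norm_hadamard_le_of_mem_schurBall {n : ℕ} {X : Matrix (Fin n) (Fin n) ℂ}
    (hX : X ∈ schurBall n) (A : Matrix (Fin n) (Fin n) ℂ) : ‖X ⊙ A‖ ≤ ‖A‖ :=
  (norm_hadamard_le_schurNorm_mul X A).trans (mul_le_of_le_one_left (norm_nonneg A) hX)

theorem norm_diag_le_one_of_mem_schurBall {n : ℕ} {X : Matrix (Fin n) (Fin n) ℂ}
    (hX : X ∈ schurBall n) (i : Fin n) : ‖X i i‖ ≤ 1 := by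
  have h := norm_hadamard_le_of_mem_schurBall hX (Matrix.diagonal fun _ => 1)
  have hd : X ⊙ Matrix.diagonal (fun _ => (1 : ℂ)) = Matrix.diagonal fun j => X j j := by
    ext j k
    by_cases hjk : j = k
    · subst hjk; simp
    · simp [hjk]
  rw [hd, Matrix.l2_opNorm_diagonal, Matrix.l2_opNorm_diagonal] at h
  refine (norm_le_pi_norm (fun j => X j j) i).trans (h.trans ?_)
  exact (pi_norm_le_iff_of_nonneg zero_le_one).2 fun _ => by simp

theorem norm_inner_toEuclideanCLM_le {n : ℕ} (A : Matrix (Fin n) (Fin n) ℂ)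
    (x y : EuclideanSpace ℂ (Fin n)) :
    ‖inner ℂ (Matrix.toEuclideanCLM (𝕜 := ℂ) A x) y‖ ≤ ‖A‖ * (‖x‖ * ‖y‖) := by
  rw [← mul_assoc]
  exact (norm_inner_le_norm _ _).trans
    (mul_le_mul_of_nonneg_right (ContinuousLinearMap.le_opNorm _ x) (norm_nonneg y))

/-- The Schur product with `∑ k, v k (v k)ᴴ` is a sum of compressions by diagonal matrices. -/
theorem inner_toEuclideanCLM_sum_vecMulVec_hadamard {m n : ℕ} (v : Fin m → Fin n → ℂ)
    (A : Matrix (Fin n) (Fin n) ℂ) (x y : EuclideanSpace ℂ (Fin n)) :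
    inner ℂ (Matrix.toEuclideanCLM (𝕜 := ℂ)
        ((∑ k, Matrix.vecMulVec (v k) (star (v k))) ⊙ A) x) y =
      ∑ k, inner ℂ
        (Matrix.toEuclideanCLM (𝕜 := ℂ) A (WithLp.toLp 2 fun j => star (v k j) * x j))
        (WithLp.toLp 2 fun i => star (v k i) * y i) := by
  simp only [EuclideanSpace.inner_eq_star_dotProduct, Matrix.ofLp_toEuclideanCLM, dotProduct,
    Matrix.mulVec, Pi.star_apply, star_sum, Matrix.hadamard_apply, Matrix.sum_apply,
    Matrix.vecMulVec_apply, Finset.mul_sum, Finset.sum_mul, star_mul', star_star]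
  rw [Finset.sum_comm (s := (Finset.univ : Finset (Fin m)))]
  refine Finset.sum_congr rfl fun i _ => ?_
  rw [Finset.sum_comm (s := (Finset.univ : Finset (Fin m)))]
  refine Finset.sum_congr rfl fun j _ => Finset.sum_congr rfl fun k _ => ?_
  ring

/-- A positive semidefinite matrix with unit diagonal is a contractive Schur multiplier. -/
theorem unitDiagPos_subset_schurBall (n : ℕ) : unitDiagPos n ⊆ schurBall n := by
  rintro X ⟨hX, hd⟩
  obtain ⟨m, v, rfl⟩ := Matrix.posSemidef_iff_eq_sum_vecMulVec.1 hX
  have hrow (i : Fin n) : ∑ k, ‖v k i‖ ^ 2 = 1 := by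
    have h := hd i
    simp only [Matrix.sum_apply, Matrix.vecMulVec_apply, Pi.star_apply] at h
    have h' : ((∑ k, ‖v k i‖ ^ 2 : ℝ) : ℂ) = 1 := by
      rw [← h]
      push_cast
      exact Finset.sum_congr rfl fun k _ => (Complex.mul_conj' (v k i)).symm
    exact_mod_cast h'
  -- The unit diagonal makes `x ↦ (star (v k) * x)_k` an isometry into a direct sum of `m` copies.
  have hnorm (x : EuclideanSpace ℂ (Fin n)) (hx : ‖x‖ = 1) :
      ∑ k, ‖(WithLp.toLp 2 fun j => star (v k j) * x j : EuclideanSpace ℂ (Fin n))‖ ^ 2 = 1 := by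
    simp only [EuclideanSpace.norm_sq_eq, norm_mul, norm_star, mul_pow]
    rw [Finset.sum_comm]
    simp only [← Finset.sum_mul, hrow, one_mul]
    rw [← EuclideanSpace.norm_sq_eq, hx, one_pow]
  refine ContinuousLinearMap.opNorm_le_bound _ zero_le_one fun A => ?_
  rw [one_mul]
  change ‖Matrix.toEuclideanCLM (𝕜 := ℂ) ((∑ k, Matrix.vecMulVec (v k) (star (v k))) ⊙ A)‖ ≤ ‖A‖
  refine ContinuousLinearMap.opNorm_le_of_re_inner_le (norm_nonneg A) fun x y hx hy => ?_
  refine (Complex.re_le_norm _).trans ?_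
  rw [inner_toEuclideanCLM_sum_vecMulVec_hadamard]
  refine (norm_sum_le _ _).trans ?_
  calc _ ≤ ∑ k, ‖A‖ *
        ((‖(WithLp.toLp 2 fun j => star (v k j) * x j : EuclideanSpace ℂ (Fin n))‖ ^ 2 +
          ‖(WithLp.toLp 2 fun j => star (v k j) * y j : EuclideanSpace ℂ (Fin n))‖ ^ 2) / 2) := by
        refine Finset.sum_le_sum fun k _ => (norm_inner_toEuclideanCLM_le A _ _).trans ?_
        refine mul_le_mul_of_nonneg_left ?_ (norm_nonneg A)
        linarith [two_mul_le_add_sq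
          ‖(WithLp.toLp 2 fun j => star (v k j) * x j : EuclideanSpace ℂ (Fin n))‖
          ‖(WithLp.toLp 2 fun j => star (v k j) * y j : EuclideanSpace ℂ (Fin n))‖]
    _ = ‖A‖ := by
        rw [← Finset.mul_sum, ← Finset.sum_div, Finset.sum_add_distrib, hnorm x hx, hnorm y hy]
        norm_num

/-- The all-ones matrix, translated by a point of the vertical line through the centre of its
spectrum, is a multiple of a unitary. -/
theorem norm_sq_ones_sub_scalar_le (n : ℕ) (s : ℝ) :
    ‖(Matrix.of fun _ _ => (1 : ℂ) : Matrix (Fin n) (Fin n) ℂ) -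
        ((n / 2 : ℝ) + s * Complex.I : ℂ) • 1‖ ^ 2 ≤ (n / 2 : ℝ) ^ 2 + s ^ 2 := by
  rw [sq, ← Matrix.l2_opNorm_conjTranspose_mul_self]
  have h : ((Matrix.of fun _ _ => (1 : ℂ) : Matrix (Fin n) (Fin n) ℂ) -
        ((n / 2 : ℝ) + s * Complex.I : ℂ) • 1)ᴴ *
      ((Matrix.of fun _ _ => (1 : ℂ)) - ((n / 2 : ℝ) + s * Complex.I : ℂ) • 1) =
      Matrix.diagonal fun _ => (((n / 2 : ℝ) ^ 2 + s ^ 2 : ℝ) : ℂ) := by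
    have hJ : (Matrix.of fun _ _ => (1 : ℂ) : Matrix (Fin n) (Fin n) ℂ)ᴴ =
        Matrix.of fun _ _ => (1 : ℂ) := by ext; simp
    have hJJ : (Matrix.of fun _ _ => (1 : ℂ) : Matrix (Fin n) (Fin n) ℂ) *
        (Matrix.of fun _ _ => (1 : ℂ)) = (n : ℂ) • Matrix.of fun _ _ => (1 : ℂ) := by
      ext; simp [Matrix.mul_apply]
    rw [Matrix.conjTranspose_sub, hJ, Matrix.conjTranspose_smul, Matrix.conjTranspose_one,
      sub_mul, mul_sub, mul_sub, hJJ]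
    ext i j
    by_cases hij : i = j
    · subst hij
      simp
      linear_combination (-(s : ℂ) ^ 2) * Complex.I_sq
    · simp [hij]
      ring
  rw [h, Matrix.l2_opNorm_diagonal]
  refine (pi_norm_le_iff_of_nonneg (by positivity)).2 fun _ => ?_
  rw [Complex.norm_real, Real.norm_of_nonneg (by positivity)]

/-- Each disc has 0 on its boundary; after expansion the condition is affine in `s`, so its slope, a
multiple of `q.im`, must vanish. -/
theorem im_eq_zero_and_re_nonneg_of_forall_norm_sub_le {q : ℂ} {a N : ℝ} (ha : 0 ≤ a) (hN : 0 < N)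
    (h : ∀ s : ℝ, ‖q - (a + s * Complex.I) * N‖ ^ 2 ≤ (a ^ 2 + s ^ 2) * N ^ 2) :
    q.im = 0 ∧ 0 ≤ q.re := by
  have key (s : ℝ) : q.re ^ 2 + q.im ^ 2 - 2 * a * N * q.re - 2 * s * N * q.im ≤ 0 := by
    have hs := h s
    rw [← Complex.normSq_eq_norm_sq, Complex.normSq_apply] at hs
    simp at hs
    nlinarith
  have him : q.im = 0 := by
    by_contra hq
    -- This `s` turns the left side of `key` into `q.re ^ 2 + q.im ^ 2 + 1`.
    have hs := key (-(2 * a * N * q.re + 1) / (2 * N * q.im))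
    have : 2 * (-(2 * a * N * q.re + 1) / (2 * N * q.im)) * N * q.im =
        -(2 * a * N * q.re + 1) := by field_simp
    nlinarith [sq_nonneg q.re, sq_nonneg q.im]
  refine ⟨him, ?_⟩
  have hs := key 0
  by_contra! hq
  have : 0 ≤ a * N := by positivity
  rw [him] at hs
  nlinarith [mul_nonneg this (neg_nonneg.2 hq.le), mul_pos_of_neg_of_neg hq hq]

/-- A contractive Schur multiplier with unit diagonal is positive semidefinite. -/
theorem posSemidef_of_mem_schurBall {n : ℕ} {X : Matrix (Fin n) (Fin n) ℂ}
    (hX : X ∈ schurBall n) (hd : ∀ i, X i i = 1) : X.PosSemidef := by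
  rw [← Matrix.isPositive_toEuclideanLin_iff, LinearMap.isPositive_iff_complex]
  intro x
  change _ = inner ℂ (Matrix.toEuclideanCLM (𝕜 := ℂ) X x) x ∧
    0 ≤ RCLike.re (inner ℂ (Matrix.toEuclideanCLM (𝕜 := ℂ) X x) x)
  suffices H : (inner ℂ (Matrix.toEuclideanCLM (𝕜 := ℂ) X x) x).im = 0 ∧
      0 ≤ (inner ℂ (Matrix.toEuclideanCLM (𝕜 := ℂ) X x) x).re from
    ⟨Complex.ext rfl H.1.symm, H.2⟩
  obtain rfl | hx := eq_or_ne x 0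
  · simp
  refine im_eq_zero_and_re_nonneg_of_forall_norm_sub_le (a := n / 2) (N := ‖x‖ ^ 2)
    (by positivity) (by positivity) fun s => ?_
  -- The sign `-s` compensates for conjugate-linearity of `inner` in its first argument.
  have hB := norm_hadamard_le_of_mem_schurBall hX ((Matrix.of fun _ _ => (1 : ℂ)) -
    ((n / 2 : ℝ) + (-s : ℝ) * Complex.I : ℂ) • 1)
  have hXB : X ⊙ ((Matrix.of fun _ _ => (1 : ℂ)) -
      ((n / 2 : ℝ) + (-s : ℝ) * Complex.I : ℂ) • 1) =
      X - ((n / 2 : ℝ) + (-s : ℝ) * Complex.I : ℂ) • 1 := by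
    ext i j
    by_cases hij : i = j
    · subst hij; simp [hd]
    · simp [hij]
  have hle := (norm_inner_toEuclideanCLM_le _ x x).trans
    (mul_le_mul_of_nonneg_right hB (by positivity))
  rw [hXB, map_sub, map_smul, map_one, sub_apply,
    smul_apply, one_apply_eq_self, inner_sub_left, inner_smul_left,
    inner_self_eq_norm_sq_to_K] at hle
  have hsq := pow_le_pow_left₀ (norm_nonneg _) hle 2
  rw [mul_pow, ← sq] at hsq
  have hfin := hsq.trans
    (mul_le_mul_of_nonneg_right (norm_sq_ones_sub_scalar_le n (-s)) (by positivity))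
  rw [neg_sq] at hfin
  have hc : ((n / 2 : ℝ) + s * Complex.I : ℂ) * (‖x‖ ^ 2 : ℝ) =
      (starRingEnd ℂ) ((n / 2 : ℝ) + (-s : ℝ) * Complex.I) * (‖x‖ : ℂ) ^ 2 := by
    rw [map_add, map_mul, Complex.conj_ofReal, Complex.conj_ofReal, Complex.conj_I]
    push_cast
    ring
  rw [hc]
  exact hfin

theorem mem_unitDiagPos_of_convexCombination {n : ℕ} {a b : ℝ}
    {X Y Z : Matrix (Fin n) (Fin n) ℂ} (ha : 0 < a) (hb : 0 < b) (hab : a + b = 1)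
    (hX : X ∈ unitDiagPos n) (hY : Y ∈ schurBall n) (hZ : Z ∈ schurBall n)
    (h : a • Y + b • Z = X) : Y ∈ unitDiagPos n := by
  have hd (i : Fin n) : Y i i = 1 := by
    have hi := congrArg Complex.re ((congrFun (congrFun h i) i).trans (hX.2 i))
    simp at hi
    have hYn := norm_diag_le_one_of_mem_schurBall hY i
    have hYre := (Complex.re_le_norm (Y i i)).trans hYn
    have hZre := (Complex.re_le_norm (Z i i)).trans (norm_diag_le_one_of_mem_schurBall hZ i)
    -- Two reals at most 1 with a weighted mean of 1, both weights positive, equal 1; the norm bound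
    -- then kills the imaginary part.
    have hre : (Y i i).re = 1 := by nlinarith
    have hsq := pow_le_pow_left₀ (norm_nonneg _) hYn 2
    rw [← Complex.normSq_eq_norm_sq, Complex.normSq_apply, hre] at hsq
    exact Complex.ext hre (by simp; nlinarith)
  exact ⟨posSemidef_of_mem_schurBall hY hd, hd⟩

theorem convex_unitDiagPos (n : ℕ) : Convex ℝ (unitDiagPos n) := by
  rintro X ⟨hX, hXd⟩ Y ⟨hY, hYd⟩ a b ha hb hab
  refine ⟨(hX.smul ha).add (hY.smul hb), fun i => ?_⟩
  simp [hXd, hYd, ← Complex.ofReal_add, hab]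

theorem mainTheorem4 (n : ℕ) :
    (Convex ℝ (unitDiagPos n) ∧ IsExtreme ℝ (schurBall n) (unitDiagPos n)) ∧
      ∀ (α : ℝ) (X Y Z : Matrix (Fin n) (Fin n) ℂ), 0 < α → α < 1 →
        X ∈ unitDiagPos n → schurNorm Y ≤ 1 → schurNorm Z ≤ 1 →
        X = (1 - α) • Y + α • Z →
        Y ∈ unitDiagPos n ∧ Z ∈ unitDiagPos n := by
  refine ⟨⟨convex_unitDiagPos n, unitDiagPos_subset_schurBall n, ?_⟩, ?_⟩
  · rintro Y hY Z hZ X hX ⟨a, b, ha, hb, hab, h⟩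
    exact mem_unitDiagPos_of_convexCombination ha hb hab hX hY hZ h
  · intro α X Y Z h0 h1 hX hY hZ h
    exact ⟨mem_unitDiagPos_of_convexCombination (sub_pos.2 h1) h0 (by ring) hX hY hZ h.symm,
      mem_unitDiagPos_of_convexCombination h0 (sub_pos.2 h1) (by ring) hX hZ hY
        ((add_comm _ _).trans h.symm)⟩
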